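/- Definitions. Let $(\Omega,\mathcal F,P)$ be a probability space and let $\Lambda$ be the lattice of all sub-$\sigma$-fields of $\mathcal F$ that contain all null sets of $\mathcal F$ (meet is intersection, join is the generated $\sigma$-field; the least element $0$ consists of the sets of probability $0$ or $1$, the greatest element $1$ is $\mathcal F$). A *noise-type Boolean algebra* is a distributive sublattice $B\subset\Lambda$ with $0,1\in B$ such that every $x\in B$ has a complement $x'\in B$ ($x\wedge x'=0$, $x\vee x'=1$) for which the $\sigma$-fields $x,x'$ are independent. For $x\in B$ let $Q_x$ be the orthogonal projection of the complex Hilbert space $L_2(\Omega,\mathcal F,P)$ onto the subspace of $x$-measurable functions, and let $\mathcal A$ be the von Neumann algebra generated by $\{Q_x: x\in B\}$. A *spectral space* of $B$ is a measurable space $(S,\Sigma)$ with (the measure class of) a finite measure $\mu$ on it and a $*$-isomorphism $\alpha:\mathcal A\to L_\infty(S,\Sigma,\mu)$; for $x\in B$ the set $S_x\in\Sigma$ is defined mod $0$ by $\alpha(Q_x)=\mathbf 1_{S_x}$. Let $X$ be a topological space and $\operatorname{Reg}(X)$ the Boolean algebra of its regular open sets; for $a\in\operatorname{Reg}(X)$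 write $\operatorname{Int}(a)$ for the regular open set itself, $\operatorname{Cl}(a)$ for its closure and $a'$ for its complement in $\operatorname{Reg}(X)$. Theorem. Let $B$ be a noise-type Boolean algebra with spectral space $(S,\Sigma,\mu)$, $\alpha$; let $A\subset\operatorname{Reg}(X)$ be a Boolean subalgebra and $h:A\to B$ a homomorphism of Boolean algebras. Consider the condition on a map $F$ from $S$ to the set of closed subsets of $X$: $$(*)\qquad S_{h(a)}=\{s\in S: F(s)\subset\operatorname{Cl}(a)\}\pmod 0\quad\text{for every } a\in A .$$ Assume (countable base) that there is a countable $A_0\subset A$ such that $\{\operatorname{Int}(a):a\in A_0\}$ is a base of the topology of $X$. (i) If, moreover, (compact inner approximation) for every $a\in A$ there are $a_1\le a_2\le\cdots$ in $A$ such that for all $n$ the set $\operatorname{Cl}(a_n)$ is compact and $\operatorname{Cl}(a_n)\subset\operatorname{Int}(a)$, and $h(a_n')\downarrow h(a')$ (that is, the intersection of the $\sigma$-fields $h(a_n')$ is $h(a')$), then there exists a map $F$ satisfying $(*)$. (ii) Any two maps $F,G$ satisfying $(*)$ are equal $\mu$-almost everywhere. -/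

import Mathlib

open MeasureTheory Set TopologicalSpace
open scoped ENNReal

noncomputable section

/-! ### Regular open sets -/

/-- The Boolean algebra of regular open subsets of `X` (meet is intersection, the complement of `r`
is the interior of `X \ r`, the join of `r` and `s` is the interior of the closure of `r ∪ s`). -/
abbrev RegOpen (X : Type*) [TopologicalSpace X] : Type _ := Heyting.Regular (Opens X)

namespace RegOpen

variable {X : Type*} [TopologicalSpace X]

/-- `r` as an open set. -/
def Int (r : RegOpen X) : Set X := ((r : Opens X) : Set X)

/-- The closure of `r`. -/
def Cl (r : RegOpen X) : Set X := closure r.Int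

/-- The elements of `RegOpen X` are indeed the open sets equal to the interior of their closure. -/
theorem isRegular_iff (U : Opens X) :
    Heyting.IsRegular U ↔ interior (closure (U : Set X)) = U := by
  rw [Heyting.IsRegular, ← SetLike.coe_set_eq, Opens.coe_compl_eq_interior_compl,
    Opens.coe_compl_eq_interior_compl, interior_compl (s := (U : Set X)), compl_compl]

theorem interior_Cl (r : RegOpen X) : interior r.Cl = r.Int := (isRegular_iff _).1 r.prop

theorem Int_compl (r : RegOpen X) : rᶜ.Int = r.Clᶜ :=
  Opens.coe_compl_eq_interior_compl.trans interior_compl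

theorem Int_inf (r s : RegOpen X) : (r ⊓ s).Int = r.Int ∩ s.Int := rfl

theorem Int_sup (r s : RegOpen X) : (r ⊔ s).Int = interior (r.Cl ∪ s.Cl) := by
  change ((((r : Opens X) ⊔ s)ᶜᶜ : Opens X) : Set X) = _
  rw [Opens.coe_compl_eq_interior_compl, Opens.coe_compl_eq_interior_compl,
    interior_compl (s := (((r : Opens X) ⊔ s : Opens X) : Set X)), compl_compl, Opens.coe_sup, closure_union]
  rfl

theorem le_iff (r s : RegOpen X) : r ≤ s ↔ r.Int ⊆ s.Int := Iff.rfl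

end RegOpen

/-! ### Noise-type Boolean algebras of σ-fields -/

/-- The trivial σ-field of a probability space: all measurable sets of probability `0` or `1`. -/
@[reducible] def nullField {Ω : Type*} [mΩ : MeasurableSpace Ω] (P : Measure Ω) : MeasurableSpace Ω where
  MeasurableSet' s := MeasurableSet s ∧ (P s = 0 ∨ P sᶜ = 0)
  measurableSet_empty := ⟨MeasurableSet.empty, Or.inl measure_empty⟩
  measurableSet_compl s hs := ⟨hs.1.compl, by rw [compl_compl]; exact hs.2.symm⟩
  measurableSet_iUnion f hf := by
    refine ⟨MeasurableSet.iUnion fun i => (hf i).1, ?_⟩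
    by_cases h : ∀ i, P (f i) = 0
    · exact Or.inl (measure_iUnion_null h)
    · push Not at h
      obtain ⟨i, hi⟩ := h
      exact Or.inr (measure_mono_null (compl_subset_compl.2 (subset_iUnion f i))
        ((hf i).2.resolve_left hi))

/-- A noise-type Boolean algebra of σ-fields on `(Ω, mΩ, P)`: a distributive sublattice of the
lattice of all those sub-σ-fields of `mΩ` that contain all null sets, containing the least and the
greatest elements of that lattice, and such that each element `x` has a complement `x'` in it with
`x` and `x'` independent. -/
structure NoiseTypeBooleanAlgebra {Ω : Type*} [mΩ : MeasurableSpace Ω] (P : Measure Ω) where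
  /-- the underlying lattice; meet is intersection, join is the generated σ-field -/
  lat : Sublattice (MeasurableSpace Ω)
  nullField_le : ∀ x ∈ lat, nullField P ≤ x
  le_top : ∀ x ∈ lat, x ≤ mΩ
  nullField_mem : nullField P ∈ lat
  top_mem : mΩ ∈ lat
  inf_sup_distrib : ∀ x ∈ lat, ∀ y ∈ lat, ∀ z ∈ lat, x ⊓ (y ⊔ z) = (x ⊓ y) ⊔ (x ⊓ z)
  exists_compl : ∀ x ∈ lat, ∃ x' ∈ lat,
    x ⊓ x' = nullField P ∧ x ⊔ x' = mΩ ∧ @ProbabilityTheory.Indep Ω x x' mΩ P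

namespace NoiseTypeBooleanAlgebra

variable {Ω : Type*} [mΩ : MeasurableSpace Ω] {P : Measure Ω}

instance : SetLike (NoiseTypeBooleanAlgebra P) (MeasurableSpace Ω) where
  coe B := B.lat
  coe_injective B C h := by
    obtain ⟨b, _⟩ := B
    obtain ⟨c, _⟩ := C
    have : b = c := SetLike.coe_injective h
    subst this
    rfl

variable {B : NoiseTypeBooleanAlgebra P}

instance : DistribLattice B :=
  @DistribLattice.ofInfSupLe B (inferInstanceAs (Lattice B.lat)) fun a b c =>
    (Subtype.ext (B.inf_sup_distrib _ a.2 _ b.2 _ c.2) :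
      min (α := B.lat) a (max (α := B.lat) b c) =
        max (α := B.lat) (min (α := B.lat) a b) (min (α := B.lat) a c)).le

instance : BoundedOrder B where
  top := ⟨mΩ, B.top_mem⟩
  le_top x := B.le_top _ x.2
  bot := ⟨nullField P, B.nullField_mem⟩
  bot_le x := B.nullField_le _ x.2

instance : ComplementedLattice B where
  exists_isCompl x := by
    obtain ⟨y, hy, h1, h2, -⟩ := B.exists_compl _ x.2
    exact ⟨⟨y, hy⟩, disjoint_iff.2 (Subtype.ext h1), codisjoint_iff.2 (Subtype.ext h2)⟩

instance : BooleanAlgebra B := DistribLattice.booleanAlgebraOfComplemented B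

/-- In `B` meet is intersection, join is the generated σ-field, and order is inclusion. -/
theorem coe_inf (x y : B) : ((x ⊓ y : B) : MeasurableSpace Ω) = x.1 ⊓ y.1 := rfl

theorem coe_sup (x y : B) : ((x ⊔ y : B) : MeasurableSpace Ω) = x.1 ⊔ y.1 := rfl

theorem coe_le {x y : B} : x ≤ y ↔ x.1 ≤ y.1 := Iff.rfl

/-! ### The projections and the von Neumann algebra -/

/-- The projection `Q_x` on `L₂(Ω, mΩ, P)`, for `x` in `B`: the orthogonal projection onto the
subspace of (classes of) `x`-measurable functions. -/
def proj (x : B) : Lp ℂ 2 P →L[ℂ] Lp ℂ 2 P :=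
  haveI : Fact (x.1 ≤ mΩ) := ⟨B.le_top x.1 x.2⟩
  (lpMeas ℂ ℂ x.1 2 P).starProjection

theorem star_proj (x : B) : star (proj x) = proj x := by
  have : Fact (x.1 ≤ mΩ) := ⟨B.le_top x.1 x.2⟩
  exact (isSelfAdjoint_starProjection _).star_eq

theorem proj_mul_self (x : B) : proj x * proj x = proj x := by
  have : Fact (x.1 ≤ mΩ) := ⟨B.le_top x.1 x.2⟩
  exact Submodule.isIdempotentElem_starProjection _

variable (B) in
/-- The von Neumann algebra generated by the projections `Q_x`, `x` in `B`: their double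
commutant. -/
def vonNeumann : VonNeumannAlgebra (Lp ℂ 2 P) where
  toStarSubalgebra := StarSubalgebra.centralizer ℂ
    (StarSubalgebra.centralizer ℂ (range (proj : B → _)) : Set (Lp ℂ 2 P →L[ℂ] Lp ℂ 2 P))
  centralizer_centralizer' := by simp

theorem proj_mem (x : B) : proj x ∈ B.vonNeumann.toStarSubalgebra := by
  refine (StarSubalgebra.mem_centralizer_iff ℂ).2 fun g hg => ?_
  have h1 := (StarSubalgebra.mem_centralizer_iff ℂ).1 hg (proj x) ⟨x, rfl⟩
  have h2 := (StarSubalgebra.mem_centralizer_iff ℂ).1 (star_mem hg) (proj x) ⟨x, rfl⟩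
  exact ⟨h1.1.symm, h2.1.symm⟩

end NoiseTypeBooleanAlgebra

/-! ### The algebra `L_∞` -/

section Linfty

variable {S : Type*} [MeasurableSpace S] {μ : Measure S}

instance : CommRing (S →ₘ[μ] ℂ) :=
  { (inferInstance : AddCommGroup (S →ₘ[μ] ℂ)), (inferInstance : CommMonoid (S →ₘ[μ] ℂ)) with
    zero_mul := fun f => AEEqFun.toGerm_injective (by simp [AEEqFun.mul_toGerm, AEEqFun.zero_toGerm])
    mul_zero := fun f => AEEqFun.toGerm_injective (by simp [AEEqFun.mul_toGerm, AEEqFun.zero_toGerm])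
    left_distrib := fun f g k => AEEqFun.toGerm_injective
      (by simp [AEEqFun.mul_toGerm, AEEqFun.add_toGerm, mul_add])
    right_distrib := fun f g k => AEEqFun.toGerm_injective
      (by simp [AEEqFun.mul_toGerm, AEEqFun.add_toGerm, add_mul]) }

instance : Algebra ℂ (S →ₘ[μ] ℂ) := Algebra.ofModule
  (fun c f g => by
    apply AEEqFun.ext
    filter_upwards [AEEqFun.coeFn_mul (c • f) g, AEEqFun.coeFn_smul c f,
      AEEqFun.coeFn_smul c (f * g), AEEqFun.coeFn_mul f g] with s h1 h2 h3 h4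
    rw [h1, h3, Pi.mul_apply, h2, Pi.smul_apply, Pi.smul_apply, h4, Pi.mul_apply, smul_mul_assoc])
  (fun c f g => by
    apply AEEqFun.ext
    filter_upwards [AEEqFun.coeFn_mul f (c • g), AEEqFun.coeFn_smul c g,
      AEEqFun.coeFn_smul c (f * g), AEEqFun.coeFn_mul f g] with s h1 h2 h3 h4
    rw [h1, h3, Pi.mul_apply, h2, Pi.smul_apply, Pi.smul_apply, h4, Pi.mul_apply, mul_smul_comm])

instance : StarRing (S →ₘ[μ] ℂ) where
  star_mul f g := by
    apply AEEqFun.ext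
    filter_upwards [AEEqFun.coeFn_star (f * g), AEEqFun.coeFn_mul f g,
      AEEqFun.coeFn_mul (star g) (star f), AEEqFun.coeFn_star f, AEEqFun.coeFn_star g]
      with s h1 h2 h3 h4 h5
    rw [h1, Pi.star_apply, h2, h3, Pi.mul_apply, Pi.mul_apply, h4, h5, star_mul, Pi.star_apply,
      Pi.star_apply]
  star_add f g := by
    apply AEEqFun.ext
    filter_upwards [AEEqFun.coeFn_star (f + g), AEEqFun.coeFn_add f g,
      AEEqFun.coeFn_add (star f) (star g), AEEqFun.coeFn_star f, AEEqFun.coeFn_star g]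
      with s h1 h2 h3 h4 h5
    simp [h1, h2, h3, h4, h5]

instance : StarModule ℂ (S →ₘ[μ] ℂ) where
  star_smul c f := by
    apply AEEqFun.ext
    filter_upwards [AEEqFun.coeFn_star (c • f), AEEqFun.coeFn_smul c f,
      AEEqFun.coeFn_smul (star c) (star f), AEEqFun.coeFn_star f] with s h1 h2 h3 h4
    rw [h1, Pi.star_apply, h2, h3, Pi.smul_apply, Pi.smul_apply, h4, star_smul, Pi.star_apply]

variable (μ) in
/-- The algebra `L_∞(S, μ)` of (classes of) essentially bounded measurable complex functions. -/
def Linfty : StarSubalgebra ℂ (S →ₘ[μ] ℂ) where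
  carrier := {f | f ∈ Lp ℂ ∞ μ}
  mul_mem' {f g} hf hg := by
    rw [mem_ofPred_eq, Lp.mem_Lp_iff_memLp] at *
    exact (memLp_congr_ae (AEEqFun.coeFn_mul f g)).2 (hg.mul hf)
  add_mem' {f g} hf hg := (Lp ℂ ∞ μ).add_mem hf hg
  algebraMap_mem' c := by
    rw [mem_ofPred_eq, Lp.mem_Lp_iff_memLp, Algebra.algebraMap_eq_smul_one]
    refine (memLp_congr_ae ?_).2 (memLp_top_const (μ := μ) c)
    filter_upwards [AEEqFun.coeFn_smul c (1 : S →ₘ[μ] ℂ), AEEqFun.coeFn_one (μ := μ) (β := ℂ)]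
      with s h1 h2
    simp [h1, h2]
  star_mem' {f} hf := by
    rw [mem_ofPred_eq, Lp.mem_Lp_iff_memLp] at *
    exact (memLp_congr_ae (AEEqFun.coeFn_star f)).2 hf.star

end Linfty
namespace NoiseTypeBooleanAlgebra

variable {Ω : Type*} [mΩ : MeasurableSpace Ω] {P : Measure Ω} {B : NoiseTypeBooleanAlgebra P}
  {S : Type*} [MeasurableSpace S] {μ : Measure S}

/-- An isomorphism of the von Neumann algebra of `B` onto `L_∞(S, μ)`; it makes `S`, with the
measure class of `μ`, the spectral space of `B`. -/
abbrev SpectralIso (B : NoiseTypeBooleanAlgebra P) (μ : Measure S) : Type _ :=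
  B.vonNeumann.toStarSubalgebra ≃⋆ₐ[ℂ] Linfty μ

/-- `α (Q_x)` as a class of functions on `S`. -/
def SpectralIso.indic (α : SpectralIso B μ) (x : B) : S →ₘ[μ] ℂ :=
  (α ⟨proj x, proj_mem x⟩ : Linfty μ)

/-- (A representative of) the set `S_x`, determined mod 0 by `α (Q_x) = 1_{S_x}`. -/
def SpectralIso.specSet (α : SpectralIso B μ) (x : B) : Set S := {s | α.indic x s = 1}

theorem SpectralIso.indic_ae_eq (α : SpectralIso B μ) (x : B) :
    α.indic x =ᵐ[μ] (α.specSet x).indicator 1 := by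
  have h : α.indic x * α.indic x = α.indic x := by
    have h0 : (⟨proj x, proj_mem x⟩ : B.vonNeumann.toStarSubalgebra) * ⟨proj x, proj_mem x⟩ =
        ⟨proj x, proj_mem x⟩ := Subtype.ext (proj_mul_self x)
    have h1 := congrArg α h0
    rw [map_mul] at h1
    exact congrArg Subtype.val h1
  filter_upwards [AEEqFun.coeFn_mul (α.indic x) (α.indic x)] with s hs
  rw [h, Pi.mul_apply] at hs
  by_cases h1 : α.indic x s = 1
  · rw [indicator_of_mem (show s ∈ α.specSet x from h1), h1, Pi.one_apply]
  · rw [indicator_of_notMem (show s ∉ α.specSet x from h1)]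
    by_contra h0
    exact h1 (mul_left_cancel₀ h0 (by rw [← hs, mul_one]))

theorem SpectralIso.measurableSet_specSet (α : SpectralIso B μ) (x : B) :
    MeasurableSet (α.specSet x) :=
  (α.indic x).measurable (measurableSet_singleton 1)

/-! ### Homomorphisms, spectral maps, and the two assumptions -/

variable {X : Type*} [TopologicalSpace X] {A : BooleanSubalgebra (RegOpen X)}

/-- `F` represents the spectral sets `S_{h(a)}` as `{s | F s ⊆ Cl a}`, mod 0. -/
def IsSpectralMap (h : BoundedLatticeHom A B) (α : SpectralIso B μ) (F : S → Closeds X) : Prop :=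
  ∀ a : A, α.specSet (h a) =ᵐ[μ] {s | (F s : Set X) ⊆ (a : RegOpen X).Cl}

/-- Countable base: some countable subset of `A` is a base of the topology of `X`. -/
def HasCountableBase (A : BooleanSubalgebra (RegOpen X)) : Prop :=
  ∃ A₀ : Set (RegOpen X), A₀ ⊆ A ∧ A₀.Countable ∧ IsTopologicalBasis (RegOpen.Int '' A₀)

/-- Compact inner approximation: for every `a` in `A` there is an increasing sequence of `a_n` in
`A` such that `Cl a_n` is compact and contained in `Int a`, and the σ-fields `h (a_n')` decrease to
the σ-field `h (a')`. -/
def HasCompactInnerApprox (h : BoundedLatticeHom A B) : Prop :=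
  ∀ a : A, ∃ u : ℕ → A, Monotone u ∧
    (∀ n, IsCompact (u n : RegOpen X).Cl ∧ (u n : RegOpen X).Cl ⊆ (a : RegOpen X).Int) ∧
    (⨅ n, (h (u n)ᶜ : MeasurableSpace Ω)) = (h aᶜ : MeasurableSpace Ω)

end NoiseTypeBooleanAlgebra

end

/-! ### Conditional expectations and projections -/

/-! The map `x ↦ S_x` turns finite meets into intersections mod 0 (`specSet_inf`), since `Q_x Q_y =
Q_{x ⊓ y}`, and respects countable intersections of σ-fields (`specSet_of_iInf`). Joins need not go
to unions, so the argument uses meets only.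

Applied to `a'`, condition (*) says that `s ∈ S_{h(a')}` iff `F(s)` misses `Int a`. Hence almost
every `F(s)` is determined by the members of a countable base that it misses, which gives
uniqueness. For existence, take `F(s)` to be the complement of the union of the basic `Int b` with
`s ∈ S_{h(b')}`. If `Int a` misses `F(s)`, each compact `Cl a_n` is covered by finitely many such
`b`; their complements have a meet below `a_n'`, so `s ∈ S_{h(a_n')}` for all `n`, and the limit
gives `s ∈ S_{h(a')}`. Each `a` involves only countably many null sets. -/

theorem MeasurableSpace.sup_eq_generateFrom_inter {Ω : Type*} (m₁ m₂ : MeasurableSpace Ω) :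
    m₁ ⊔ m₂ = generateFrom
      {s | ∃ t u, MeasurableSet[m₁] t ∧ MeasurableSet[m₂] u ∧ t ∩ u = s} := by
  apply le_antisymm
  · refine sup_le (fun s hs => ?_) (fun s hs => ?_)
    · exact measurableSet_generateFrom ⟨s, univ, hs, MeasurableSet.univ, inter_univ s⟩
    · exact measurableSet_generateFrom ⟨univ, s, MeasurableSet.univ, hs, univ_inter s⟩
  · refine generateFrom_le ?_
    rintro _ ⟨t, u, ht, hu, rfl⟩
    exact MeasurableSet.inter (le_sup_left (a := m₁) (b := m₂) t ht)
      (le_sup_right (a := m₁) (b := m₂) u hu)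

theorem isPiSystem_inter {Ω : Type*} (m₁ m₂ : MeasurableSpace Ω) :
    IsPiSystem {s | ∃ t u, MeasurableSet[m₁] t ∧ MeasurableSet[m₂] u ∧ t ∩ u = s} := by
  rintro _ ⟨t, u, ht, hu, rfl⟩ _ ⟨t', u', ht', hu', rfl⟩ -
  exact ⟨t ∩ t', u ∩ u', ht.inter ht', hu.inter hu', inter_inter_inter_comm _ _ _ _⟩

section

variable {Ω : Type*} [mΩ : MeasurableSpace Ω] {P : Measure Ω}

theorem ProbabilityTheory.Indep.setIntegral_eq [IsProbabilityMeasure P]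
    {m₁ m₂ : MeasurableSpace Ω} (h₁ : m₁ ≤ mΩ) (h₂ : m₂ ≤ mΩ) (h : Indep m₁ m₂ P) {f : Ω → ℂ} (hf : StronglyMeasurable[m₁] f)
    (hfi : Integrable f P) {s : Set Ω} (hs : MeasurableSet[m₂] s) :
    ∫ ω in s, f ω ∂P = P.real s • ∫ ω, f ω ∂P := by
  rw [← setIntegral_condExp h₂ hfi hs,
    integral_congr_ae (ae_restrict_of_ae (condExp_indep_eq h₁ h₂ hf h)), setIntegral_const]

/-- The field `w` carries no information on `y`-measurable functions. It suffices to integrate over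
the π-system of sets `t ∩ u` with `t` in `z`, `u` in `w`. -/
theorem MeasureTheory.condExp_sup_eq_of_indep [IsProbabilityMeasure P]
    {y z w y' : MeasurableSpace Ω} (hy : y ≤ mΩ) (hy' : y' ≤ mΩ)
    (hzy : z ≤ y) (hwy' : w ≤ y') (hind : ProbabilityTheory.Indep y y' P)
    {f : Ω → ℂ} (hf : StronglyMeasurable[y] f) (hfi : Integrable f P) :
    P[f | z ⊔ w] =ᵐ[P] P[f | z] := by
  have hz : z ≤ mΩ := hzy.trans hy
  have hw : w ≤ mΩ := hwy'.trans hy'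
  have hzw : z ⊔ w ≤ mΩ := sup_le hz hw
  refine (ae_eq_condExp_of_forall_setIntegral_eq hzw hfi
    (fun s _ _ => integrable_condExp.integrableOn) (fun s hs _ => ?_)
    (stronglyMeasurable_condExp.mono (le_sup_left (a := z) (b := w))).aestronglyMeasurable).symm
  refine MeasurableSpace.induction_on_inter
    (C := fun s _ => ∫ ω in s, (P[f | z]) ω ∂P = ∫ ω in s, f ω ∂P)
    (MeasurableSpace.sup_eq_generateFrom_inter z w) (isPiSystem_inter z w) ?_ ?_ ?_ ?_ s hs
  · simp
  · rintro _ ⟨t, u, ht, hu, rfl⟩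
    -- Used twice, for `f` and for `P[f | z]`: both are `y`-measurable, so `P u` factors out.
    have key : ∀ g : Ω → ℂ, StronglyMeasurable[y] g → Integrable g P →
        ∫ ω in t ∩ u, g ω ∂P = P.real u • ∫ ω in t, g ω ∂P := by
      intro g hg hgi
      have h1 := ProbabilityTheory.Indep.setIntegral_eq (mΩ := mΩ) hy hy' hind
        (hg.indicator (hzy t ht)) (hgi.indicator (hz t ht)) (hwy' u hu)
      rwa [setIntegral_indicator (hz t ht), integral_indicator (hz t ht), inter_comm] at h1
    rw [key _ (stronglyMeasurable_condExp.mono hzy) integrable_condExp, key f hf hfi,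
      setIntegral_condExp hz hfi ht]
  · intro t ht h
    have e1 := integral_add_compl (hzw t ht) (integrable_condExp (μ := P) (m := z) (f := f))
    have e2 := integral_add_compl (hzw t ht) hfi
    rw [integral_condExp hz, ← e2, h] at e1
    exact add_left_cancel e1
  · intro s hd hs h
    rw [integral_iUnion (fun i => hzw _ (hs i)) hd integrable_condExp.integrableOn,
      integral_iUnion (fun i => hzw _ (hs i)) hd hfi.integrableOn]
    exact tsum_congr h

theorem measurable_of_ae_eq_of_nullField_le {m : MeasurableSpace Ω}
    (hm : @nullField Ω mΩ P ≤ m) {f g : Ω → ℂ} (hf : Measurable[mΩ] f) (hg : Measurable[m] g)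
    (hgΩ : Measurable[mΩ] g) (hfg : f =ᵐ[P] g) : Measurable[m] f := by
  intro U hU
  have hnull : ∀ s t : Set Ω, MeasurableSet[mΩ] s → MeasurableSet[mΩ] t → s =ᵐ[P] t →
      MeasurableSet[m] (s \ t) := fun s t hs ht hst =>
    hm _ ⟨MeasurableSet.diff hs ht, Or.inl (ae_le_set.1 hst.le)⟩
  have hae : f ⁻¹' U =ᵐ[P] g ⁻¹' U := by
    filter_upwards [hfg] with ω hω
    exact congrArg (· ∈ U) hω
  have h1 := hnull _ _ (hf hU) (hgΩ hU) hae
  have h2 := hnull _ _ (hgΩ hU) (hf hU) hae.symm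
  have : f ⁻¹' U = (g ⁻¹' U \ (g ⁻¹' U \ f ⁻¹' U)) ∪ (f ⁻¹' U \ g ⁻¹' U) := by
    rw [sdiff_sdiff_right_self, inter_comm, inter_union_sdiff]
  rw [this]
  exact (MeasurableSet.diff (hg hU) h2).union h1

namespace NoiseTypeBooleanAlgebra

variable {B : NoiseTypeBooleanAlgebra P}

theorem proj_ae_eq_condExp [IsProbabilityMeasure P] (x : B) (f : Lp ℂ 2 P) :
    proj x f =ᵐ[P] P[f | x.1] := by
  have h := (Lp.memLp f).condExpL2_ae_eq_condExp (𝕜 := ℂ) (B.le_top x.1 x.2)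
  rw [Lp.toLp_coeFn] at h
  exact h

theorem proj_eq_self_iff (x : B) (f : Lp ℂ 2 P) :
    proj x f = f ↔ AEStronglyMeasurable[x.1] f P := by
  have : Fact (x.1 ≤ mΩ) := ⟨B.le_top x.1 x.2⟩
  rw [← mem_lpMeas_iff_aestronglyMeasurable (𝕜 := ℂ)]
  exact Submodule.starProjection_eq_self_iff

/-- By distributivity `x = (x ⊓ y) ⊔ (x ⊓ y')`, and the second part is independent of `y`. -/
theorem condExp_eq_condExp_inf [IsProbabilityMeasure P] (x y : B) {f : Ω → ℂ}
    (hf : StronglyMeasurable[y.1] f) (hfi : Integrable f P) : P[f | x.1] =ᵐ[P] P[f | (x ⊓ y : B).1] := by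
  obtain ⟨y', h2, h3⟩ : ∃ y' : B, y.1 ⊔ y'.1 = mΩ ∧ ProbabilityTheory.Indep y.1 y'.1 P := by
    obtain ⟨y', hy', -, h⟩ := B.exists_compl y.1 y.2
    exact ⟨⟨y', hy'⟩, h⟩
  have hx : x.1 = (x.1 ⊓ y.1) ⊔ (x.1 ⊓ y'.1) := by
    rw [← B.inf_sup_distrib _ x.2 _ y.2 _ y'.2, h2, inf_eq_left.2 (B.le_top _ x.2)]
  have h4 := condExp_sup_eq_of_indep (B.le_top _ y.2) (B.le_top _ y'.2)
    (inf_le_right (a := x.1)) (inf_le_right (a := x.1)) h3 hf hfi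
  rwa [← hx] at h4

theorem proj_mul_proj [IsProbabilityMeasure P] (x y : B) : proj x * proj y = proj (x ⊓ y) := by
  refine ContinuousLinearMap.ext fun f => Lp.ext ?_
  have hy := proj_ae_eq_condExp y f
  calc (proj x (proj y f) : Ω → ℂ) =ᵐ[P] P[proj y f | x.1] := proj_ae_eq_condExp _ _
    _ =ᵐ[P] P[P[f | y.1] | x.1] := condExp_congr_ae hy
    _ =ᵐ[P] P[P[f | y.1] | (x ⊓ y : B).1] :=
      condExp_eq_condExp_inf x y stronglyMeasurable_condExp integrable_condExp
    _ =ᵐ[P] P[f | (x ⊓ y : B).1] :=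
      condExp_condExp_of_le (coe_le.1 inf_le_right) (B.le_top _ y.2)
    _ =ᵐ[P] proj (x ⊓ y) f := (proj_ae_eq_condExp _ _).symm

/-- A.e. measurability would allow a different representative for each `n`. As every `u n` contains
the null sets, one fixed representative is measurable for all of them, hence for their intersection.
-/
theorem proj_eq_self_of_iInf {x : B} {u : ℕ → B}
    (hu : (⨅ n, (u n : MeasurableSpace Ω)) = x) {f : Lp ℂ 2 P} (hf : ∀ n, proj (u n) f = f) :
    proj x f = f := by
  have hmeas : ∀ n, Measurable[(u n).1] f := fun n => by
    obtain ⟨g, hg, hfg⟩ := (proj_eq_self_iff (u n) f).1 (hf n)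
    exact measurable_of_ae_eq_of_nullField_le (B.nullField_le _ (u n).2)
      (Lp.stronglyMeasurable f).measurable hg.measurable
      (hg.measurable.mono (B.le_top _ (u n).2) le_rfl) hfg
  rw [proj_eq_self_iff, ← hu]
  refine (Measurable.stronglyMeasurable ?_).aestronglyMeasurable
  intro U hU
  exact MeasurableSpace.measurableSet_iInf.2 fun n => hmeas n hU

end NoiseTypeBooleanAlgebra

end

/-! ### Spectral sets -/

theorem indicator_mem_Linfty {S : Type*} [MeasurableSpace S] {μ : Measure S} {E : Set S}
    (hE : MeasurableSet E) :
    AEEqFun.mk (E.indicator (1 : S → ℂ))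
      (stronglyMeasurable_one.indicator hE).aestronglyMeasurable ∈ Linfty μ := by
  change _ ∈ Lp ℂ ∞ μ
  rw [Lp.mem_Lp_iff_memLp]
  exact (memLp_congr_ae (AEEqFun.coeFn_mk _ _)).2 ((memLp_top_const (1 : ℂ)).indicator hE)

namespace NoiseTypeBooleanAlgebra

section

variable {Ω : Type*} [mΩ : MeasurableSpace Ω] {P : Measure Ω}
  {B : NoiseTypeBooleanAlgebra P} {S : Type*} [MeasurableSpace S] {μ : Measure S}

namespace SpectralIso

theorem specSet_inf [IsProbabilityMeasure P] (α : SpectralIso B μ) (x y : B) :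
    α.specSet (x ⊓ y) =ᵐ[μ] (α.specSet x ∩ α.specSet y : Set S) := by
  have h : α.indic x * α.indic y = α.indic (x ⊓ y) := by
    have h0 : (⟨proj x, proj_mem x⟩ : B.vonNeumann.toStarSubalgebra) * ⟨proj y, proj_mem y⟩ =
        ⟨proj (x ⊓ y), proj_mem (x ⊓ y)⟩ := Subtype.ext (proj_mul_proj x y)
    have h1 := congrArg α h0
    rw [map_mul] at h1
    exact congrArg Subtype.val h1
  filter_upwards [AEEqFun.coeFn_mul (α.indic x) (α.indic y), α.indic_ae_eq x, α.indic_ae_eq y]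
    with s hs hx hy
  rw [h, Pi.mul_apply, hx, hy] at hs
  refine propext ?_
  change α.indic (x ⊓ y) s = 1 ↔ s ∈ α.specSet x ∩ α.specSet y
  rw [hs]
  by_cases h1 : s ∈ α.specSet x <;> by_cases h2 : s ∈ α.specSet y <;> simp [h1, h2]

theorem specSet_mono [IsProbabilityMeasure P] (α : SpectralIso B μ) {x y : B}
    (hxy : x ≤ y) :
    ∀ᵐ s ∂μ, s ∈ α.specSet x → s ∈ α.specSet y := by
  have h := α.specSet_inf x y
  rw [inf_eq_left.2 hxy] at h
  filter_upwards [h.mem_iff] with s hs hx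
  exact (hs.1 hx).2

theorem specSet_top (α : SpectralIso B μ) : ∀ᵐ s ∂μ, s ∈ α.specSet ⊤ := by
  have h : α.indic ⊤ = 1 := by
    have h0 : (⟨proj ⊤, proj_mem ⊤⟩ : B.vonNeumann.toStarSubalgebra) = 1 := by
      refine Subtype.ext (ContinuousLinearMap.ext fun f => ?_)
      exact (proj_eq_self_iff ⊤ f).2 (Lp.aestronglyMeasurable f)
    rw [SpectralIso.indic, h0, map_one]
    rfl
  filter_upwards [AEEqFun.coeFn_one (μ := μ) (β := ℂ)] with s hs
  change α.indic ⊤ s = 1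
  rw [h, hs, Pi.one_apply]

theorem specSet_finset_inf [IsProbabilityMeasure P] {ι : Type*} (α : SpectralIso B μ)
    (t : Finset ι) (x : ι → B) :
    ∀ᵐ s ∂μ, (∀ i ∈ t, s ∈ α.specSet (x i)) → s ∈ α.specSet (t.inf x) := by
  classical
  induction t using Finset.induction_on with
  | empty => simpa using α.specSet_top
  | insert i t _ ih =>
    rw [Finset.inf_insert]
    filter_upwards [ih, (α.specSet_inf (x i) (t.inf x)).mem_iff] with s h1 h2 h3
    exact h2.2 ⟨h3 i (Finset.mem_insert_self i t),
      h1 fun j hj => h3 j (Finset.mem_insert_of_mem hj)⟩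

/-- Only the algebraic properties of `α` are used: pull the indicator of `⋂ S_{u n}` back to an
operator `T`. Its range lies in that of every `Q_{u n}`, hence in that of `Q_x`, so `Q_x T = T`;
then apply `α` again. -/
theorem specSet_of_iInf (α : SpectralIso B μ) {x : B} {u : ℕ → B}
    (hu : (⨅ n, (u n : MeasurableSpace Ω)) = x) :
    ∀ᵐ s ∂μ, (∀ n, s ∈ α.specSet (u n)) → s ∈ α.specSet x := by
  have hE : MeasurableSet (⋂ n, α.specSet (u n)) :=
    MeasurableSet.iInter fun n => α.measurableSet_specSet (u n)
  set e : S →ₘ[μ] ℂ := AEEqFun.mk _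
    (stronglyMeasurable_one.indicator hE).aestronglyMeasurable
  have hes : e =ᵐ[μ] (⋂ n, α.specSet (u n)).indicator 1 := AEEqFun.coeFn_mk _ _
  let T := α.symm ⟨e, indicator_mem_Linfty hE⟩
  have hT : α T = ⟨e, indicator_mem_Linfty hE⟩ := α.apply_symm_apply _
  have hn : ∀ n, proj (u n) * T.1 = T.1 := fun n => by
    have h1 : α.indic (u n) * e = e := by
      apply AEEqFun.ext
      filter_upwards [AEEqFun.coeFn_mul (α.indic (u n)) e, α.indic_ae_eq (u n), hes]
        with s h1 h2 h3
      rw [h1, Pi.mul_apply, h2, h3]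
      by_cases hs : s ∈ ⋂ n, α.specSet (u n)
      · simp [indicator_of_mem (mem_iInter.1 hs n)]
      · simp [indicator_of_notMem hs]
    have h2 : (⟨proj (u n), proj_mem (u n)⟩ : B.vonNeumann.toStarSubalgebra) * T = T := by
      apply EquivLike.injective α
      rw [map_mul, hT]
      exact Subtype.ext h1
    exact congrArg Subtype.val h2
  have hx : (⟨proj x, proj_mem x⟩ : B.vonNeumann.toStarSubalgebra) * T = T :=
    Subtype.ext (ContinuousLinearMap.ext fun f =>
      proj_eq_self_of_iInf hu fun n => DFunLike.congr_fun (hn n) f)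
  have h3 : α.indic x * e = e := by
    have h4 := congrArg α hx
    rw [map_mul, hT] at h4
    exact congrArg Subtype.val h4
  filter_upwards [AEEqFun.coeFn_mul (α.indic x) e, hes] with s h1 h2 hs
  rw [h3, Pi.mul_apply, h2, indicator_of_mem (mem_iInter.2 hs), Pi.one_apply, mul_one] at h1
  exact h1.symm

end SpectralIso

end

/-! ### The spectral map -/

theorem disjoint_Int_iff_subset_Cl_compl {X : Type*} [TopologicalSpace X] (F : Set X)
    (a : RegOpen X) : Disjoint F a.Int ↔ F ⊆ aᶜ.Cl := by
  have h : a.Int = aᶜ.Clᶜ := by rw [← RegOpen.Int_compl, compl_compl]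
  rw [h, disjoint_compl_right_iff_subset]

section

variable {Ω : Type*} [mΩ : MeasurableSpace Ω] {P : Measure Ω}
  {B : NoiseTypeBooleanAlgebra P} {S : Type*} [MeasurableSpace S] {μ : Measure S}
  {X : Type*} [TopologicalSpace X] {A : BooleanSubalgebra (RegOpen X)}

theorem IsSpectralMap.mem_iff {h : BoundedLatticeHom A B} {α : SpectralIso B μ}
    {F : S → Closeds X} (hF : IsSpectralMap h α F) (a : A) :
    ∀ᵐ s ∂μ, s ∈ α.specSet (h aᶜ) ↔ Disjoint (F s : Set X) (a : RegOpen X).Int := by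
  filter_upwards [(hF aᶜ).mem_iff] with s hs
  rw [hs, disjoint_Int_iff_subset_Cl_compl]
  rfl

theorem _root_.TopologicalSpace.IsTopologicalBasis.closeds_eq {b : Set (Set X)}
    (hb : IsTopologicalBasis b) {F G : Closeds X}
    (hFG : ∀ U ∈ b, Disjoint (F : Set X) U ↔ Disjoint (G : Set X) U) : F = G := by
  have key : ∀ F G : Closeds X, (∀ U ∈ b, Disjoint (G : Set X) U → Disjoint (F : Set X) U) →
      F ≤ G := by
    intro F G hU x hx
    by_contra hxG
    obtain ⟨U, hUb, hxU, hUG⟩ := hb.mem_nhds_iff.1 (G.isClosed.isOpen_compl.mem_nhds hxG)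
    exact disjoint_left.1 (hU U hUb (subset_compl_iff_disjoint_left.1 hUG)) hx hxU
  exact le_antisymm (key F G fun U hU => (hFG U hU).2) (key G F fun U hU => (hFG U hU).1)

theorem IsSpectralMap.ae_eq {h : BoundedLatticeHom A B} {α : SpectralIso B μ}
    (hbase : HasCountableBase A) {F G : S → Closeds X} (hF : IsSpectralMap h α F)
    (hG : IsSpectralMap h α G) : F =ᵐ[μ] G := by
  obtain ⟨A₀, hA, hc, hb⟩ := hbase
  have := hc.to_subtype
  have hall : ∀ᵐ s ∂μ, ∀ a : A₀,
      Disjoint (F s : Set X) a.1.Int ↔ Disjoint (G s : Set X) a.1.Int := by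
    refine ae_all_iff.2 fun a => ?_
    filter_upwards [hF.mem_iff ⟨a, hA a.2⟩, hG.mem_iff ⟨a, hA a.2⟩] with s h1 h2
    exact h1.symm.trans h2
  filter_upwards [hall] with s hs
  refine hb.closeds_eq ?_
  rintro _ ⟨a, ha, rfl⟩
  exact hs ⟨a, ha⟩

/-- The complement of the union of those members `b` of `A₀` for which `s` is in the spectral set
of `h (bᶜ)`. -/
def spectralMap (h : BoundedLatticeHom A B) (α : SpectralIso B μ) (A₀ : Set A) (s : S) :
    Closeds X where
  carrier := (⋃ b ∈ {b ∈ A₀ | s ∈ α.specSet (h bᶜ)}, (b : RegOpen X).Int)ᶜ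
  isClosed' := (isOpen_biUnion fun (b : A) _ => (b : RegOpen X).1.isOpen).isClosed_compl

theorem disjoint_spectralMap_iff (h : BoundedLatticeHom A B) (α : SpectralIso B μ) (A₀ : Set A)
    (s : S) (U : Set X) : Disjoint (spectralMap h α A₀ s : Set X) U ↔
      U ⊆ ⋃ b ∈ {b ∈ A₀ | s ∈ α.specSet (h bᶜ)}, (b : RegOpen X).Int := by
  rw [disjoint_comm, ← subset_compl_iff_disjoint_right]
  change U ⊆ (_ᶜ)ᶜ ↔ _
  rw [compl_compl]

theorem isSpectralMap_spectralMap [IsProbabilityMeasure P] {h : BoundedLatticeHom A B}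
    (α : SpectralIso B μ) (happrox : HasCompactInnerApprox h) {A₀ : Set A} (hc : A₀.Countable)
    (hb : IsTopologicalBasis ((fun a : A => (a : RegOpen X).Int) '' A₀)) :
    IsSpectralMap h α (spectralMap h α A₀) := by
  have := hc.to_subtype
  have key : ∀ a : A, ∀ᵐ s ∂μ, s ∈ α.specSet (h aᶜ) ↔
      Disjoint (spectralMap h α A₀ s : Set X) (a : RegOpen X).Int := by
    intro a
    obtain ⟨u, -, hu, hinf⟩ := happrox a
    have h1 : ∀ᵐ s ∂μ, ∀ b : A₀, b.1 ≤ a → s ∈ α.specSet (h aᶜ) → s ∈ α.specSet (h b.1ᶜ) := by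
      refine ae_all_iff.2 fun b => ?_
      by_cases hba : b.1 ≤ a
      · filter_upwards [α.specSet_mono (OrderHomClass.mono h (compl_le_compl hba))] with s hs _
        exact hs
      · exact .of_forall fun s h => absurd h hba
    -- The finite subcover will depend on `s`, so the null set must serve all finite `t` at once;
    -- there are countably many.
    have h2 : ∀ᵐ s ∂μ, ∀ (n : ℕ) (t : Finset A₀), u n ≤ t.sup (fun b => b.1) →
        (∀ b ∈ t, s ∈ α.specSet (h b.1ᶜ)) → s ∈ α.specSet (h (u n)ᶜ) := by
      refine ae_all_iff.2 fun n => ae_all_iff.2 fun t => ?_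
      by_cases hut : u n ≤ t.sup (fun b => b.1)
      · have hle : t.inf (fun b : A₀ => h b.1ᶜ) ≤ h (u n)ᶜ := by
          have e : t.inf (fun b : A₀ => h b.1ᶜ) = h (t.sup fun b : A₀ => b.1)ᶜ := by
            rw [Finset.compl_sup, map_finset_inf]
            rfl
          rw [e]
          exact OrderHomClass.mono h (compl_le_compl hut)
        filter_upwards [α.specSet_finset_inf t (fun b : A₀ => h b.1ᶜ), α.specSet_mono hle]
          with s hs1 hs2 _ hs3
        exact hs2 (hs1 hs3)
      · exact .of_forall fun s h => absurd h hut
    filter_upwards [h1, h2, α.specSet_of_iInf hinf] with s hs1 hs2 hs3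
    rw [disjoint_spectralMap_iff]
    constructor
    · intro hs p hp
      obtain ⟨_, ⟨b, hbA, rfl⟩, hpb, hba⟩ :=
        hb.mem_nhds_iff.1 ((a : RegOpen X).1.isOpen.mem_nhds hp)
      exact mem_iUnion₂.2 ⟨b, ⟨hbA, hs1 ⟨b, hbA⟩ hba hs⟩, hpb⟩
    · intro hsub
      refine hs3 fun n => ?_
      have hcov : (u n : RegOpen X).Cl ⊆
          ⋃ b : {b : A₀ // s ∈ α.specSet (h b.1ᶜ)}, (b.1.1 : RegOpen X).Int := by
        intro p hp
        obtain ⟨b, ⟨hbA, hbs⟩, hpb⟩ := mem_iUnion₂.1 (hsub ((hu n).2 hp))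
        exact mem_iUnion.2 ⟨⟨⟨b, hbA⟩, hbs⟩, hpb⟩
      obtain ⟨t, ht⟩ := (hu n).1.elim_finite_subcover _
        (fun b : {b : A₀ // s ∈ α.specSet (h b.1ᶜ)} => (b.1.1 : RegOpen X).1.isOpen) hcov
      refine hs2 n (t.map (Function.Embedding.subtype _)) ?_ ?_
      -- The join in `RegOpen X` may exceed the union of the `Int b`, but containing it is enough.
      · refine (RegOpen.le_iff (u n : RegOpen X) _).2 ?_
        refine subset_closure.trans (ht.trans (iUnion₂_subset fun b hbt => ?_))
        exact (Finset.le_sup (f := fun b : A₀ => b.1)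
          (Finset.mem_map_of_mem (Function.Embedding.subtype _) hbt) : b.1.1 ≤ _)
      · intro b hbt
        obtain ⟨c, -, rfl⟩ := Finset.mem_map.1 hbt
        exact c.2
  intro a
  -- Missing `Int a'` is the same as lying in `Cl a`.
  filter_upwards [key aᶜ] with s hs
  refine propext ?_
  rw [compl_compl, disjoint_Int_iff_subset_Cl_compl] at hs
  change s ∈ α.specSet (h a) ↔ (spectralMap h α A₀ s : Set X) ⊆ (a : RegOpen X).Cl
  rw [hs, BooleanSubalgebra.val_compl, compl_compl]

end

end NoiseTypeBooleanAlgebra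

theorem mainTheorem3 {Ω : Type*} [mΩ : MeasurableSpace Ω] {P : Measure Ω} [IsProbabilityMeasure P]
    (B : NoiseTypeBooleanAlgebra P)
    {S : Type*} [MeasurableSpace S] {μ : Measure S} [IsFiniteMeasure μ]
    (α : NoiseTypeBooleanAlgebra.SpectralIso B μ)
    {X : Type*} [TopologicalSpace X] (A : BooleanSubalgebra (RegOpen X))
    (h : BoundedLatticeHom A B)
    (hbase : NoiseTypeBooleanAlgebra.HasCountableBase A) :
    (NoiseTypeBooleanAlgebra.HasCompactInnerApprox h →
      ∃ F : S → Closeds X, NoiseTypeBooleanAlgebra.IsSpectralMap h α F) ∧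
    (∀ F G : S → Closeds X, NoiseTypeBooleanAlgebra.IsSpectralMap h α F →
      NoiseTypeBooleanAlgebra.IsSpectralMap h α G → F =ᵐ[μ] G) := by
  refine ⟨fun happrox => ?_, fun F G hF hG => hF.ae_eq hbase hG⟩
  obtain ⟨A₀, hA, hc, hb⟩ := hbase
  refine ⟨NoiseTypeBooleanAlgebra.spectralMap h α {a : A | (a : RegOpen X) ∈ A₀},
    NoiseTypeBooleanAlgebra.isSpectralMap_spectralMap α happrox
      (hc.preimage Subtype.val_injective) ?_⟩
  convert hb using 1
  ext U
  constructor
  · rintro ⟨a, ha, rfl⟩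
    exact ⟨a, ha, rfl⟩
  · rintro ⟨a, ha, rfl⟩
    exact ⟨⟨a, hA ha⟩, ha, rfl⟩
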